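/- Let $\mathcal H$ be a separable (possibly finite-dimensional) complex Hilbert space with orthonormal basis $(e_i)$, let $X$ be a locally compact Hausdorff space with Borel $\sigma$-algebra $\mathcal O(X)$, and let $\mathcal S(\mathcal H)$ be the set of density operators (positive operators of trace one). Let $\nu:\mathcal O(X)\to\mathcal B(\mathcal H)$ be a positive operator-valued measure, i.e. $\nu(E)\ge 0$ for all $E$, and for pairwise disjoint $E_k$ one has $\nu(\bigcup_{k}E_k)=\sum_k\nu(E_k)$ ultraweakly, that is, after applying $\operatorname{tr}(s\,\cdot)$ for every $s\in\mathcal S(\mathcal H)$. Let $\rho\in\mathcal S(\mathcal H)$ be of full rank (injective), and let $\nu_\rho(E)=\operatorname{tr}(\rho\,\nu(E))$, a finite positive measure. A quantum random variable is a function $f:X\to\mathcal B(\mathcal H)$ such that $x\mapsto\operatorname{tr}(sf(x))$ is Borel measurable for every $s\in\mathcal S(\mathcal H)$. Assume that the Radon–Nikodým derivative $D=\frac{d\nu}{d\nu_\rho}$, whose matrix entries are $\langle D e_j,e_i\rangle=\frac{d\nu_{ij}}{d\nu_\rho}$ with $\nu_{ij}(E)=\langle\nu(E)e_j,e_i\rangle$,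 is a quantum random variable with values in $\mathcal B(\mathcal H)$. Let $\mathcal L_{\mathcal H}(X,\nu)$ be the complex linear span of the positive quantum random variables. For $f\in\mathcal L_{\mathcal H}(X,\nu)$ and real $p,q\ge 1$ define, with values in $[0,\infty]$, \[ \|f\|_{S^p,L^q}=\sup_{s\in\mathcal S(\mathcal H)}\left(\int_X\left\|s^{1/2}D^{1/2}fD^{1/2}s^{1/2}\right\|_{S^p}^{q}\,d\nu_\rho\right)^{1/q},\qquad \|A\|_{S^p}=\operatorname{tr}(|A|^p)^{1/p}, \] \[ \|f\|_q=\inf\ \sup_{s\in\mathcal S(\mathcal H)}\left(\int_X \operatorname{tr}\!\left(sD^{1/2}(f_1+f_2+f_3+f_4)D^{1/2}\right)^q d\nu_\rho\right)^{1/q}, \] where the infimum is over all $f_1,f_2,f_3,f_4\in\mathcal L_{\mathcal H}(X,\nu)$ with $f_k\ge 0$ and $f=f_1-f_2+if_3-if_4$. Then: \begin{enumerate} \item for all real $p,q\ge1$, $\|\cdot\|_{S^p,L^q}$ is a seminorm on $\mathcal L_{\mathcal H}(X,\nu)$ with values in $[0,\infty]$: $\|0\|_{S^p,L^q}=0$,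 $\|\lambda f\|_{S^p,L^q}=|\lambda|\,\|f\|_{S^p,L^q}$ for $\lambda\in\mathbb C$ (with $0\cdot\infty=0$), and $\|f+g\|_{S^p,L^q}\le\|f\|_{S^p,L^q}+\|g\|_{S^p,L^q}$; \item $\|f\|_{S^p,L^q}\le\|f\|_{S^r,L^q}$ for all $f\in\mathcal L_{\mathcal H}(X,\nu)$ and all real $p\ge r\ge 1$, $q\ge1$; \item $\|f\|_{S^1,L^q}\le\|f\|_q$ for all $f\in\mathcal L_{\mathcal H}(X,\nu)$ and all real $q\ge 1$. \end{enumerate} -/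

import Mathlib

open MeasureTheory
open scoped ENNReal InnerProductSpace

namespace OpLp

noncomputable section

variable {ι : Type*} {H : Type*} [NormedAddCommGroup H] [InnerProductSpace ℂ H] [CompleteSpace H]

/-- The trace `∑ᵢ ⟨A eᵢ, eᵢ⟩` of a trace-class operator, computed in the orthonormal basis `e`. -/
def trace (e : HilbertBasis ι ℂ H) (A : H →L[ℂ] H) : ℂ :=
  ∑' i, ⟪e i, A (e i)⟫_ℂ

/-- The trace of a positive operator, with values in `[0, ∞]`. -/
def posTrace (e : HilbertBasis ι ℂ H) (A : H →L[ℂ] H) : ℝ≥0∞ :=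
  ∑' i, ENNReal.ofReal (⟪e i, A (e i)⟫_ℂ).re

/-- The density operators: positive operators of trace one. -/
def states (e : HilbertBasis ι ℂ H) : Set (H →L[ℂ] H) :=
  {s | 0 ≤ s ∧ posTrace e s = 1}

/-- The Schatten norm `tr(|A|^p)^{1/p}`, with values in `[0, ∞]`. -/
def schattenNorm (e : HilbertBasis ι ℂ H) (p : ℝ) (A : H →L[ℂ] H) : ℝ≥0∞ :=
  posTrace e ((CFC.abs A) ^ p) ^ (1 / p)

/-- The series `∑ₖ Aₖ` converges to `S` in the ultraweak topology, that is, after applying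
`tr(s ·)` for every density operator `s`. -/
def HasUltraweakSum (e : HilbertBasis ι ℂ H) (A : ℕ → H →L[ℂ] H) (S : H →L[ℂ] H) : Prop :=
  ∀ s ∈ states e, HasSum (fun k => trace e (s * A k)) (trace e (s * S))

/-- A positive operator-valued measure: an ultraweakly countably additive map from the measurable
sets to the positive operators (values at non-measurable sets are irrelevant). -/
structure POVM (X : Type*) [MeasurableSpace X] (e : HilbertBasis ι ℂ H) where
  /-- the value at a set -/
  toFun : Set X → H →L[ℂ] H
  nonneg : ∀ E, MeasurableSet E → 0 ≤ toFun E
  iUnion : ∀ E : ℕ → Set X, (∀ k, MeasurableSet (E k)) → Pairwise (Function.onFun Disjoint E) →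
    HasUltraweakSum e (fun k => toFun (E k)) (toFun (⋃ k, E k))

/-- For a density operator `s` and a positive operator `A` one has `0 ≤ tr(sA)`. -/
theorem trace_mul_re_nonneg (e : HilbertBasis ι ℂ H) {s A : H →L[ℂ] H} (hs : s ∈ states e)
    (hA : 0 ≤ A) : 0 ≤ (trace e (s * A)).re := by
  obtain ⟨hs0, hs1⟩ := hs
  set B : H →L[ℂ] H := CFC.sqrt s with hB
  have hBB : B * B = s := CFC.sqrt_mul_sqrt_self s hs0
  have hBpos : 0 ≤ B := CFC.sqrt_nonneg s
  have hBsymm : ∀ x y : H, ⟪B x, y⟫_ℂ = ⟪x, B y⟫_ℂ := fun x y =>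
    ((ContinuousLinearMap.nonneg_iff_isPositive B).1 hBpos).isSymmetric x y
  have hApos := (ContinuousLinearMap.nonneg_iff_isPositive A).1 hA
  have hAsymm : ∀ x y : H, ⟪A x, y⟫_ℂ = ⟪x, A y⟫_ℂ := fun x y => hApos.isSymmetric x y
  have parseval : ∀ x : H, HasSum (fun i => ‖⟪e i, x⟫_ℂ‖ ^ 2) (‖x‖ ^ 2) := by
    intro x
    have h := e.hasSum_inner_mul_inner x x
    have h2 := Complex.hasSum_re h
    have h3 : (⟪x, x⟫_ℂ).re = ‖x‖ ^ 2 := by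
      rw [inner_self_eq_norm_sq_to_K]; norm_cast
    rw [h3] at h2
    convert h2 using 2 with i
    rw [← inner_conj_symm x (e i), Complex.conj_mul']
    norm_cast
  have hBsum : Summable fun i => ‖B (e i)‖ ^ 2 := by
    have h1 : ∀ i, (⟪e i, s (e i)⟫_ℂ).re = ‖B (e i)‖ ^ 2 := by
      intro i
      rw [← hBB, mul_apply_eq_comp, ← hBsymm, inner_self_eq_norm_sq_to_K]
      norm_cast
    have h2 : ∑' i, ENNReal.ofReal (‖B (e i)‖ ^ 2) ≠ ∞ := by
      have : posTrace e s ≠ ∞ := by rw [hs1]; simp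
      simpa [posTrace, h1] using this
    have h3 := ENNReal.summable_toReal h2
    refine h3.congr fun i => ?_
    rw [ENNReal.toReal_ofReal (by positivity)]
  have hABsum : Summable fun i => ‖A (B (e i))‖ ^ 2 := by
    refine Summable.of_nonneg_of_le (fun i => by positivity) (fun i => ?_)
      (hBsum.mul_left (‖A‖ ^ 2))
    rw [← mul_pow]
    gcongr
    exact A.le_opNorm _
  have hP1 : Summable fun x : ι × ι => ‖⟪e x.2, B (e x.1)⟫_ℂ‖ ^ 2 := by
    rw [summable_prod_of_nonneg (fun x => by positivity)]
    refine ⟨fun i => (parseval (B (e i))).summable, ?_⟩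
    exact hBsum.congr fun i => (parseval (B (e i))).tsum_eq.symm
  have hP2 : Summable fun x : ι × ι => ‖⟪e x.1, A (B (e x.2))⟫_ℂ‖ ^ 2 := by
    have : Summable fun x : ι × ι => ‖⟪e x.2, A (B (e x.1))⟫_ℂ‖ ^ 2 := by
      rw [summable_prod_of_nonneg (fun x => by positivity)]
      refine ⟨fun i => (parseval (A (B (e i)))).summable, ?_⟩
      exact hABsum.congr fun i => (parseval (A (B (e i)))).tsum_eq.symm
    exact this.prod_symm
  have hswap : ∀ i j, ⟪e j, B (A (e i))⟫_ℂ = ⟪A (B (e j)), e i⟫_ℂ := by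
    intro i j
    rw [hAsymm, hBsymm]
  have hF : Summable (Function.uncurry
      fun i j : ι => ⟪B (e i), e j⟫_ℂ * ⟪e j, B (A (e i))⟫_ℂ) := by
    refine Summable.of_norm_bounded (hP1.add hP2) ?_
    rintro ⟨i, j⟩
    simp only [Function.uncurry, norm_mul]
    rw [hswap, norm_inner_symm (B (e i)), norm_inner_symm (A (B (e j)))]
    nlinarith [sq_nonneg (‖⟪e j, B (e i)⟫_ℂ‖ - ‖⟪e i, A (B (e j))⟫_ℂ‖),
      sq_nonneg (‖⟪e j, B (e i)⟫_ℂ‖), sq_nonneg ‖⟪e i, A (B (e j))⟫_ℂ‖]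
  have key : trace e (s * A) = ∑' j, ⟪A (B (e j)), B (e j)⟫_ℂ := by
    have h1 : ∀ i, ⟪e i, (s * A) (e i)⟫_ℂ = ∑' j, ⟪B (e i), e j⟫_ℂ * ⟪e j, B (A (e i))⟫_ℂ := by
      intro i
      rw [(e.hasSum_inner_mul_inner _ _).tsum_eq, hBsymm, ← hBB]
      rfl
    unfold trace
    rw [tsum_congr h1, ← hF.tsum_comm]
    refine tsum_congr fun j => ?_
    rw [← (e.hasSum_inner_mul_inner (A (B (e j))) (B (e j))).tsum_eq]
    refine tsum_congr fun i => ?_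
    rw [hswap, hBsymm, mul_comm]
  rw [key]
  by_cases hsum : Summable fun j => ⟪A (B (e j)), B (e j)⟫_ℂ
  · rw [Complex.re_tsum hsum]
    exact tsum_nonneg fun j => hApos.re_inner_nonneg_left (B (e j))
  · rw [tsum_eq_zero_of_not_summable hsum]; simp

variable {X : Type*} [MeasurableSpace X]

/-- The finite positive measure `ν_ρ(E) = tr(ρ ν(E))`. -/
def scalarMeasure {e : HilbertBasis ι ℂ H} (ν : POVM X e) {ρ : H →L[ℂ] H}
    (hρ : ρ ∈ states e) : Measure X :=
  Measure.ofMeasurable (fun E _ => ENNReal.ofReal (trace e (ρ * ν.toFun E)).re)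
    (by
      have h := ν.iUnion (fun _ => ∅) (fun _ => MeasurableSet.empty)
        (fun _ _ _ => disjoint_bot_left) ρ hρ
      have h0 := (summable_const_iff _).1 h.summable
      simp [h0])
    (by
      intro E hE hd
      have h := Complex.hasSum_re (ν.iUnion E hE hd ρ hρ)
      have hn : ∀ k, 0 ≤ (trace e (ρ * ν.toFun (E k))).re := fun k =>
        trace_mul_re_nonneg e hρ (ν.nonneg _ (hE k))
      rw [← h.tsum_eq, ENNReal.ofReal_tsum_of_nonneg hn h.summable])

/-- A quantum random variable: an operator-valued function `f` such that `x ↦ tr(s f(x))` is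
measurable for every density operator `s`. -/
def IsQuantumRV (e : HilbertBasis ι ℂ H) (f : X → H →L[ℂ] H) : Prop :=
  ∀ s ∈ states e, Measurable fun x => trace e (s * f x)

/-- The linear span of the positive quantum random variables. -/
def quantumSpan (X : Type*) [MeasurableSpace X] (e : HilbertBasis ι ℂ H) :
    Submodule ℂ (X → H →L[ℂ] H) :=
  Submodule.span ℂ {f | IsQuantumRV e f ∧ ∀ x, 0 ≤ f x}

/-- `D` is a (version of the) Radon–Nikodým derivative `dν/dν_ρ` with values in the bounded
operators: it is a quantum random variable, and its matrix entries in the basis `e` are the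
Radon–Nikodým derivatives of the complex measures `ν_{ij}(E) = ⟨ν(E) e_j, e_i⟩`. -/
structure IsRNDeriv {e : HilbertBasis ι ℂ H} (ν : POVM X e) {ρ : H →L[ℂ] H}
    (hρ : ρ ∈ states e) (D : X → H →L[ℂ] H) : Prop where
  isQuantumRV : IsQuantumRV e D
  integrable : ∀ i j, Integrable (fun x => ⟪e i, D x (e j)⟫_ℂ) (scalarMeasure ν hρ)
  setIntegral : ∀ i j E, MeasurableSet E →
    ⟪e i, ν.toFun E (e j)⟫_ℂ = ∫ x in E, ⟪e i, D x (e j)⟫_ℂ ∂(scalarMeasure ν hρ)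

/-- The function `x ↦ D(x)^{1/2} f(x) D(x)^{1/2}`. -/
def sandwich (D f : X → H →L[ℂ] H) (x : X) : H →L[ℂ] H :=
  CFC.sqrt (D x) * f x * CFC.sqrt (D x)

/-- `f_s(x) = tr(s D(x)^{1/2} f(x) D(x)^{1/2})`. -/
def stateFun (e : HilbertBasis ι ℂ H) (D : X → H →L[ℂ] H) (s : H →L[ℂ] H)
    (f : X → H →L[ℂ] H) (x : X) : ℂ :=
  trace e (s * sandwich D f x)

/-- The 4-tuples of positive elements of the span with `f = f₁ - f₂ + i f₃ - i f₄`. -/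
def posDecomp (e : HilbertBasis ι ℂ H) (f : X → H →L[ℂ] H) : Set (Fin 4 → X → H →L[ℂ] H) :=
  {g | (∀ k, g k ∈ quantumSpan X e ∧ ∀ x, 0 ≤ g k x) ∧
    f = g 0 - g 1 + Complex.I • g 2 - Complex.I • g 3}

/-- `‖f‖_q`: the infimum over the positive decompositions of `f` of
`sup_s ‖(f₁ + f₂ + f₃ + f₄)_s‖_{L^q(μ)}`. -/
def qNorm (e : HilbertBasis ι ℂ H) (μ : Measure X) (D : X → H →L[ℂ] H) (q : ℝ)
    (f : X → H →L[ℂ] H) : ℝ≥0∞ :=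
  ⨅ g ∈ posDecomp e f, ⨆ s ∈ states e,
    (∫⁻ x, ‖stateFun e D s (g 0 + g 1 + g 2 + g 3) x‖ₑ ^ q ∂μ) ^ (1 / q)

/-- `‖f‖_{S^p,L^q} = sup_s ‖ ‖s^{1/2} D^{1/2} f D^{1/2} s^{1/2}‖_{S^p} ‖_{L^q(μ)}`. -/
def schattenLNorm (e : HilbertBasis ι ℂ H) (μ : Measure X) (D : X → H →L[ℂ] H) (p q : ℝ)
    (f : X → H →L[ℂ] H) : ℝ≥0∞ :=
  ⨆ s ∈ states e,
    (∫⁻ x, schattenNorm e p (CFC.sqrt s * sandwich D f x * CFC.sqrt s) ^ q ∂μ) ^ (1 / q)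

/-- `N` restricts to a seminorm with values in `[0, ∞]` on the complex vector space `L`
(with the convention `0 · ∞ = 0`). -/
structure IsSeminormOn {V : Type*} [AddCommGroup V] [Module ℂ V] (L : Submodule ℂ V)
    (N : V → ℝ≥0∞) : Prop where
  map_zero : N 0 = 0
  smul : ∀ (c : ℂ), ∀ f ∈ L, N (c • f) = ‖c‖ₑ * N f
  add_le : ∀ f ∈ L, ∀ g ∈ L, N (f + g) ≤ N f + N g

end

end OpLp

/-! For a density operator `s` the root `s^{1/2}` is Hilbert–Schmidt, hence compact, so every
operator `s^{1/2} D^{1/2} f D^{1/2} s^{1/2}` is compact even though `D^{1/2} f D^{1/2}` is merely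
bounded. Pointwise in `x`, the Schatten norm is therefore the `ℓ^p` norm of a sequence of singular
values (`exists_isSVD`).

Monotonicity in the exponent is then that of `ℓ^p` norms. For the triangle inequality, the singular
values of `A + B` are its diagonal entries in its own singular vectors, hence sums of entries of `A`
and of `B`. By Minkowski it suffices that the diagonal entries of `A` along any two orthonormal
families have `ℓ^p` norm at most that of its singular values. This follows from Jensen and Bessel,
as a doubly substochastic matrix relates the two (`IsSVD.tsum_enorm_inner_rpow_le`).

Minkowski in `L^q` and the supremum over `s` then give the seminorm. This step needs measurable
integrands: quantum random variables are weakly measurable, and over a separable space weak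
measurability survives products and continuous functional calculus.

The last comparison combines the triangle inequality in `S^1` with cyclicity: for `A ≥ 0` the trace
norm of `s^{1/2} A s^{1/2}` is its trace, which is `tr(sA)`. -/

namespace OpLp

noncomputable section

open Filter Topology Polynomial

set_option linter.unusedSectionVars false

universe u

/-! ### Polynomial approximation of the functional calculus. -/

section FunctionalCalculus

variable {A : Type*} [CStarAlgebra A]

/-- A continuous real function is approximated by polynomials in the functional calculus, the same
polynomials serving all self-adjoint elements at once. -/
theorem exists_polynomial_tendsto_cfc (f : ℝ → ℝ) (hf : Continuous f) :
    ∃ P : ℕ → ℝ[X], (∀ x, Tendsto (fun n => (P n).eval x) atTop (𝓝 (f x))) ∧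
      ∀ a : A, IsSelfAdjoint a → Tendsto (fun n => aeval a (P n)) atTop (𝓝 (cfc f a)) := by
  -- Weierstrass on the growing intervals `[-n, n]`, with error below `1 / (n + 1)`: every bounded
  -- spectrum is eventually covered, so the polynomials need not depend on the element.
  have h : ∀ n : ℕ, ∃ p : ℝ[X], ∀ x ∈ Set.Icc (-(n : ℝ)) n, |p.eval x - f x| < 1 / ((n : ℝ) + 1) :=
    fun n => exists_polynomial_near_of_continuousOn _ _ f hf.continuousOn _ (by positivity)
  choose P hP using h
  have hlim : ∀ (R : ℝ) (ε : ℝ), 0 < ε → ∀ᶠ n in atTop, ∀ x, |x| ≤ R → |(P n).eval x - f x| < ε := by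
    intro R ε hε
    obtain ⟨N, hN⟩ := exists_nat_gt R
    have h2 := (tendsto_one_div_add_atTop_nhds_zero_nat (𝕜 := ℝ)).eventually (gt_mem_nhds hε)
    filter_upwards [h2, eventually_ge_atTop N] with n hn hNn x hx
    have h3 : (N : ℝ) ≤ n := by exact_mod_cast hNn
    exact (hP n x (abs_le.1 (by linarith))).trans hn
  refine ⟨P, fun x => ?_, fun a ha => ?_⟩
  · rw [Metric.tendsto_nhds]
    intro ε hε
    filter_upwards [hlim |x| ε hε] with n hn
    exact hn x le_rfl
  have h1 : ∀ n, aeval a (P n) = cfc (P n).eval a := fun n => (cfc_polynomial (P n) a ha).symm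
  simp_rw [h1]
  refine tendsto_cfc_fun ?_ (.of_forall fun n => (P n).continuous.continuousOn)
  rw [Metric.tendstoUniformlyOn_iff]
  intro ε hε
  -- The factor `‖1‖` allows for the zero algebra, where `‖1‖ = 0`.
  filter_upwards [hlim (‖a‖ * ‖(1 : A)‖) ε hε] with n hn x hx
  rw [dist_comm, Real.dist_eq]
  exact hn x (spectrum.norm_le_norm_mul_of_mem hx)

end FunctionalCalculus

variable {ι κ : Type*} {H : Type u} [NormedAddCommGroup H] [InnerProductSpace ℂ H] [CompleteSpace H]
variable {X : Type*} [MeasurableSpace X]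

/-! ### Weak measurability of operator-valued functions. -/

/-- An orthonormal basis of a separable Hilbert space is countable. -/
theorem countable_of_hilbertBasis [TopologicalSpace.SeparableSpace H] (e : HilbertBasis ι ℂ H) :
    Countable ι := by
  -- Distinct basis vectors are at distance `√2 > 1`.
  have hd : Pairwise (Function.onFun Disjoint fun i => Metric.ball (e i) (1 / 2)) := by
    intro i j hij
    refine Metric.ball_disjoint_ball ?_
    have h := norm_sub_sq (𝕜 := ℂ) (e i) (e j)
    rw [e.orthonormal.2 hij, e.orthonormal.1, e.orthonormal.1] at h
    norm_num at h
    rw [dist_eq_norm]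
    nlinarith [norm_nonneg (e i - e j)]
  exact hd.countable_of_isOpen_disjoint (fun i => Metric.isOpen_ball)
    (fun i => ⟨e i, Metric.mem_ball_self (by norm_num)⟩)

/-- An operator-valued function all of whose matrix coefficients are measurable. -/
def WeaklyMeasurable (F : X → H →L[ℂ] H) : Prop :=
  ∀ u v, Measurable fun x => ⟪u, F x v⟫_ℂ

namespace WeaklyMeasurable

variable {F G : X → H →L[ℂ] H}

theorem const (T : H →L[ℂ] H) : WeaklyMeasurable fun _ : X => T :=
  fun _ _ => measurable_const

theorem add (hF : WeaklyMeasurable F) (hG : WeaklyMeasurable G) :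
    WeaklyMeasurable fun x => F x + G x := by
  intro u v
  simp only [_root_.add_apply, inner_add_right]
  exact (hF u v).add (hG u v)

theorem smul (c : ℂ) (hF : WeaklyMeasurable F) : WeaklyMeasurable fun x => c • F x := by
  intro u v
  simpa [inner_smul_right] using (hF u v).const_mul c

/-- A coefficient of the product expands over an orthonormal basis as a series of products of
coefficients, and separability makes the series countable. -/
theorem mul [TopologicalSpace.SeparableSpace H] (hF : WeaklyMeasurable F)
    (hG : WeaklyMeasurable G) : WeaklyMeasurable fun x => F x * G x := by
  intro u v
  obtain ⟨w, e, -⟩ := exists_hilbertBasis ℂ H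
  have := countable_of_hilbertBasis e
  have h : ∀ x, ⟪u, (F x * G x) v⟫_ℂ = ∑' i, ⟪u, F x (e i)⟫_ℂ * ⟪e i, G x v⟫_ℂ := by
    intro x
    have h1 := e.hasSum_inner_mul_inner ((F x).adjoint u) (G x v)
    simp_rw [ContinuousLinearMap.adjoint_inner_left] at h1
    exact h1.tsum_eq.symm
  simp_rw [h]
  exact Measurable.tsum fun i => (hF u (e i)).mul (hG (e i) v)

theorem star (hF : WeaklyMeasurable F) : WeaklyMeasurable fun x => star (F x) := by
  intro u v
  have h : ∀ x, ⟪u, (Star.star (F x)) v⟫_ℂ = (starRingEnd ℂ) ⟪v, F x u⟫_ℂ := by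
    intro x
    rw [ContinuousLinearMap.star_eq_adjoint, ContinuousLinearMap.adjoint_inner_right,
      inner_conj_symm]
  simp_rw [h]
  exact Complex.continuous_conj.measurable.comp (hF v u)

theorem pow [TopologicalSpace.SeparableSpace H] (hF : WeaklyMeasurable F) (n : ℕ) :
    WeaklyMeasurable fun x => F x ^ n := by
  induction n with
  | zero => simpa using const (X := X) (1 : H →L[ℂ] H)
  | succ n ih => simpa only [pow_succ] using ih.mul hF

theorem polynomial_aeval [TopologicalSpace.SeparableSpace H] (hF : WeaklyMeasurable F)
    (p : ℝ[X]) : WeaklyMeasurable fun x => aeval (F x) p := by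
  induction p using Polynomial.induction_on' with
  | add p q hp hq => simpa using hp.add hq
  | monomial n a =>
    have h : ∀ x, aeval (F x) (monomial n a) = (a : ℂ) • F x ^ n := by
      intro x
      rw [aeval_monomial, Algebra.algebraMap_eq_smul_one, smul_mul_assoc, one_mul,
        Complex.coe_smul]
    simpa only [h] using (hF.pow n).smul (a : ℂ)

theorem of_tendsto {F : ℕ → X → H →L[ℂ] H} (hF : ∀ n, WeaklyMeasurable (F n))
    (h : ∀ x, Tendsto (fun n => F n x) atTop (𝓝 (G x))) : WeaklyMeasurable G := by
  intro u v
  refine measurable_of_tendsto_metrizable (fun n => hF n u v) ?_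
  rw [tendsto_pi_nhds]
  intro x
  have h1 : Continuous fun T : H →L[ℂ] H => ⟪u, T v⟫_ℂ := by fun_prop
  exact (h1.tendsto _).comp (h x)

theorem cfc [TopologicalSpace.SeparableSpace H] (hF : WeaklyMeasurable F)
    (hsa : ∀ x, IsSelfAdjoint (F x)) {f : ℝ → ℝ} (hf : Continuous f) :
    WeaklyMeasurable fun x => _root_.cfc f (F x) := by
  obtain ⟨P, -, hP⟩ := exists_polynomial_tendsto_cfc (A := H →L[ℂ] H) f hf
  exact of_tendsto (fun n => hF.polynomial_aeval (P n)) fun x => hP (F x) (hsa x)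

/-- Nonnegativity of the quadratic form is a closed condition on the vector, so a dense sequence of
vectors suffices to test it. -/
theorem measurableSet_nonneg [TopologicalSpace.SeparableSpace H] (hF : WeaklyMeasurable F) :
    MeasurableSet {x | 0 ≤ F x} := by
  let K : Set ℂ := {z | 0 ≤ z.re ∧ z.im = 0}
  have hK : IsClosed K :=
    (isClosed_le continuous_const Complex.continuous_re).inter
      (isClosed_eq Complex.continuous_im continuous_const)
  have h : {x | 0 ≤ F x} = ⋂ n, {x | ⟪TopologicalSpace.denseSeq H n,
      F x (TopologicalSpace.denseSeq H n)⟫_ℂ ∈ K} := by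
    ext x
    simp only [Set.mem_ofPred_eq, Set.mem_iInter]
    rw [ContinuousLinearMap.nonneg_iff_isPositive, ContinuousLinearMap.isPositive_iff_complex]
    have key : (∀ v, ⟪v, F x v⟫_ℂ ∈ K) ↔
        ∀ n, ⟪TopologicalSpace.denseSeq H n, F x (TopologicalSpace.denseSeq H n)⟫_ℂ ∈ K := by
      refine ⟨fun h n => h _, fun h v => ?_⟩
      have hc : IsClosed {v | ⟪v, F x v⟫_ℂ ∈ K} := hK.preimage (by fun_prop)
      have := (TopologicalSpace.denseRange_denseSeq H).closure_range
      have h2 : closure (Set.range (TopologicalSpace.denseSeq H)) ⊆ {v | ⟪v, F x v⟫_ℂ ∈ K} :=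
        hc.closure_subset_iff.2 (by rintro _ ⟨n, rfl⟩; exact h n)
      rw [this] at h2
      exact h2 (Set.mem_univ v)
    rw [← key]
    refine forall_congr' fun v => ?_
    rw [← inner_conj_symm v]
    simp only [K, Set.mem_ofPred_eq, Complex.conj_re, Complex.conj_im, neg_eq_zero]
    rw [Complex.ext_iff]
    simp [and_comm, eq_comm]
  rw [h]
  exact MeasurableSet.iInter fun n => (hF _ _) hK.measurableSet

-- Since `CFC.sqrt` takes the default value zero off the positive operators, `F` may be replaced by
-- zero on the measurable set where it is not positive.
open Classical in
theorem sqrt [TopologicalSpace.SeparableSpace H] (hF : WeaklyMeasurable F) :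
    WeaklyMeasurable fun x => CFC.sqrt (F x) := by
  have hG : WeaklyMeasurable fun x => if 0 ≤ F x then F x else 0 := by
    intro u v
    have h : (fun x => ⟪u, (if 0 ≤ F x then F x else 0) v⟫_ℂ) =
        fun x => if 0 ≤ F x then ⟪u, F x v⟫_ℂ else 0 := by
      funext x; split_ifs <;> simp
    rw [h]
    exact Measurable.ite hF.measurableSet_nonneg (hF u v) measurable_const
  have hG0 : ∀ x, 0 ≤ if 0 ≤ F x then F x else 0 := by
    intro x; split_ifs with h
    · exact h
    · exact le_rfl
  have h : ∀ x, CFC.sqrt (F x) = _root_.cfc Real.sqrt (if 0 ≤ F x then F x else 0) := by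
    intro x
    rw [← cfcₙ_eq_cfc, ← CFC.sqrt_eq_real_sqrt _ (hG0 x)]
    split_ifs with h
    · rfl
    · rw [CFC.sqrt_of_not_nonneg h, CFC.sqrt_zero]
  simp_rw [h]
  exact hG.cfc (fun x => (hG0 x).isSelfAdjoint) Real.continuous_sqrt

theorem abs [TopologicalSpace.SeparableSpace H] (hF : WeaklyMeasurable F) :
    WeaklyMeasurable fun x => CFC.abs (F x) :=
  (hF.star.mul hF).sqrt

theorem rpow [TopologicalSpace.SeparableSpace H] (hF : WeaklyMeasurable F) (h0 : ∀ x, 0 ≤ F x)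
    {p : ℝ} (hp : 0 ≤ p) : WeaklyMeasurable fun x => F x ^ p := by
  simp_rw [CFC.rpow_eq_cfc_real (ha := h0 _)]
  exact hF.cfc (fun x => (h0 x).isSelfAdjoint) (Real.continuous_rpow_const hp)

theorem posTrace [TopologicalSpace.SeparableSpace H] (e : HilbertBasis ι ℂ H)
    (hF : WeaklyMeasurable F) : Measurable fun x => OpLp.posTrace e (F x) := by
  have := countable_of_hilbertBasis e
  exact Measurable.tsum fun i =>
    (Complex.measurable_re.comp (hF (e i) (e i))).ennreal_ofReal

theorem schattenNorm [TopologicalSpace.SeparableSpace H] (e : HilbertBasis ι ℂ H)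
    (hF : WeaklyMeasurable F) {p : ℝ} (hp : 0 ≤ p) :
    Measurable fun x => OpLp.schattenNorm e p (F x) :=
  ((hF.abs.rpow (fun _ => CFC.abs_nonneg _) hp).posTrace e).pow_const _

end WeaklyMeasurable

/-! ### Parseval's identity and traces of positive operators. -/

/-- Bessel's inequality in `[0, ∞]`. -/
theorem tsum_enorm_inner_sq_le {v : κ → H} (hv : Orthonormal ℂ v) (x : H) :
    ∑' k, ‖⟪v k, x⟫_ℂ‖ₑ ^ 2 ≤ ‖x‖ₑ ^ 2 := by
  have h := ENNReal.ofReal_le_ofReal (hv.tsum_inner_products_le x)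
  rw [ENNReal.ofReal_tsum_of_nonneg (fun _ => by positivity) (hv.inner_products_summable x)] at h
  simpa [ENNReal.ofReal_pow, ofReal_norm] using h

theorem hasSum_norm_inner_sq (e : HilbertBasis ι ℂ H) (x : H) :
    HasSum (fun i => ‖⟪e i, x⟫_ℂ‖ ^ 2) (‖x‖ ^ 2) := by
  have h2 := Complex.hasSum_re (e.hasSum_inner_mul_inner x x)
  have h3 : (⟪x, x⟫_ℂ).re = ‖x‖ ^ 2 := by
    rw [inner_self_eq_norm_sq_to_K]; norm_cast
  rw [h3] at h2
  convert h2 using 2 with i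
  rw [← inner_conj_symm x (e i), Complex.conj_mul']
  norm_cast

/-- Parseval's identity in `[0, ∞]`. -/
theorem tsum_enorm_inner_sq (e : HilbertBasis ι ℂ H) (x : H) :
    ∑' i, ‖⟪e i, x⟫_ℂ‖ₑ ^ 2 = ‖x‖ₑ ^ 2 := by
  have h := hasSum_norm_inner_sq e x
  have h1 := congrArg ENNReal.ofReal h.tsum_eq
  rw [ENNReal.ofReal_tsum_of_nonneg (fun _ => by positivity) h.summable] at h1
  simpa [ENNReal.ofReal_pow, ofReal_norm] using h1

theorem inner_sqrt_left (P : H →L[ℂ] H) (x y : H) :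
    ⟪CFC.sqrt P x, y⟫_ℂ = ⟪x, CFC.sqrt P y⟫_ℂ :=
  ((ContinuousLinearMap.nonneg_iff_isPositive _).1 (CFC.sqrt_nonneg P)).isSymmetric x y

theorem ofReal_re_inner_eq {P : H →L[ℂ] H} (hP : 0 ≤ P) (x : H) :
    ENNReal.ofReal (⟪x, P x⟫_ℂ).re = ‖CFC.sqrt P x‖ₑ ^ 2 := by
  have h : (⟪x, P x⟫_ℂ).re = ‖CFC.sqrt P x‖ ^ 2 := by
    conv_lhs => rw [← CFC.sqrt_mul_sqrt_self P hP, mul_apply_eq_comp, ← inner_sqrt_left,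
      inner_self_eq_norm_sq_to_K]
    norm_cast
  rw [h, ENNReal.ofReal_pow (norm_nonneg _), ofReal_norm]

theorem posTrace_eq_tsum_sqrt (e : HilbertBasis ι ℂ H) {P : H →L[ℂ] H} (hP : 0 ≤ P) :
    posTrace e P = ∑' i, ‖CFC.sqrt P (e i)‖ₑ ^ 2 :=
  tsum_congr fun _ => ofReal_re_inner_eq hP _

/-- The trace of a positive operator does not depend on the orthonormal basis. -/
theorem posTrace_eq_posTrace (e : HilbertBasis ι ℂ H) (f : HilbertBasis κ ℂ H) {P : H →L[ℂ] H}
    (hP : 0 ≤ P) : posTrace e P = posTrace f P := by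
  rw [posTrace_eq_tsum_sqrt e hP, posTrace_eq_tsum_sqrt f hP]
  -- Both traces become the same double sum of squared matrix entries of `P^{1/2}`, and Tonelli
  -- exchanges the order.
  simp_rw [← tsum_enorm_inner_sq f (CFC.sqrt P (e _)), ← tsum_enorm_inner_sq e (CFC.sqrt P (f _))]
  rw [ENNReal.tsum_comm]
  refine tsum_congr fun j => tsum_congr fun i => ?_
  rw [← inner_sqrt_left, ← ofReal_norm, ← ofReal_norm, norm_inner_symm]

/-! ### Compactness and singular values. -/

/-- The square root of a positive operator of finite trace is compact. -/
theorem isCompactOperator_sqrt (e : HilbertBasis ι ℂ H) {P : H →L[ℂ] H} (hP : 0 ≤ P)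
    (htr : posTrace e P ≠ ∞) : IsCompactOperator (CFC.sqrt P : H →L[ℂ] H) := by
  classical
  set B := CFC.sqrt P with hB
  rw [posTrace_eq_tsum_sqrt e hP, ← hB] at htr
  -- `T F` is `B` followed by the projection onto the span of the `e i`, `i ∈ F`. It has finite
  -- rank, and `‖B - T F‖²` is at most the tail of `∑ ‖B eᵢ‖²`.
  let T : Finset ι → H →L[ℂ] H := fun F => ∑ i ∈ F, InnerProductSpace.rankOne ℂ (e i) (B (e i))
  have hT : ∀ F x j, ⟪e j, (B - T F) x⟫_ℂ = if j ∈ F then 0 else ⟪B (e j), x⟫_ℂ := by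
    intro F x j
    have h1 : ⟪e j, T F x⟫_ℂ = ∑ i ∈ F, if j = i then ⟪B (e i), x⟫_ℂ else 0 := by
      simp only [T, _root_.sum_apply, inner_sum, InnerProductSpace.rankOne_apply, inner_smul_right,
        orthonormal_iff_ite.1 e.orthonormal]
      simp
    rw [_root_.sub_apply, inner_sub_right, h1, ← inner_sqrt_left, Finset.sum_ite_eq]
    rw [← hB]
    split_ifs <;> simp
  have hbound : ∀ F x, ‖(B - T F) x‖ₑ ^ 2 ≤
      (∑' j : {j // j ∉ F}, ‖B (e j)‖ₑ ^ 2) * ‖x‖ₑ ^ 2 := by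
    intro F x
    rw [← tsum_enorm_inner_sq e, ← ENNReal.tsum_mul_right]
    simp_rw [hT]
    rw [← tsum_subtype_eq_of_support_subset (s := {j | j ∉ F})]
    · refine ENNReal.tsum_le_tsum fun j => ?_
      have hj : (j : ι) ∉ F := j.2
      rw [if_neg hj, ← mul_pow]
      gcongr
      rw [← ofReal_norm, ← ofReal_norm, ← ofReal_norm,
        ← ENNReal.ofReal_mul (norm_nonneg _)]
      exact ENNReal.ofReal_le_ofReal (norm_inner_le_norm _ _)
    · intro j hj hjF
      simp [hjF] at hj
  refine isCompactOperator_of_tendsto (l := atTop) (F := T) (f := B) ?_ (.of_forall fun F => ?_)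
  · rw [Metric.tendsto_nhds]
    intro ε hε
    have h := (ENNReal.tendsto_tsum_compl_atTop_zero htr).eventually
      (gt_mem_nhds (show (0 : ℝ≥0∞) < ENNReal.ofReal ((ε / 2) ^ 2) by
        rw [ENNReal.ofReal_pos]; positivity))
    filter_upwards [h] with F hF
    rw [dist_comm, dist_eq_norm]
    refine lt_of_le_of_lt (ContinuousLinearMap.opNorm_le_bound _ (by positivity : 0 ≤ ε / 2)
      fun x => ?_) (half_lt_self hε)
    have h1 := (hbound F x).trans (mul_le_mul_left hF.le (‖x‖ₑ ^ 2))
    rw [← ofReal_norm, ← ofReal_norm, ← ENNReal.ofReal_pow (norm_nonneg _),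
      ← ENNReal.ofReal_pow (norm_nonneg _), ← ENNReal.ofReal_mul (by positivity),
      ENNReal.ofReal_le_ofReal_iff (by positivity), ← mul_pow] at h1
    exact (pow_le_pow_iff_left₀ (norm_nonneg _) (by positivity) two_ne_zero).1 h1
  · have h1 : ∀ i, IsCompactOperator (InnerProductSpace.rankOne ℂ (e i) (B (e i)) : H →L[ℂ] H) := by
      intro i
      have h2 : IsCompactOperator (innerSL ℂ (B (e i))) :=
        isCompactOperator_of_locallyCompactSpace_dom (innerSL ℂ (B (e i)))
      exact h2.clm_comp (ContinuousLinearMap.toSpanSingleton ℂ (e i))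
    induction F using Finset.induction_on with
    | empty => simpa [T] using isCompactOperator_zero
    | insert i F hi ih =>
      simp only [T, Finset.sum_insert hi]
      exact (h1 i).add ih

/-- The functional calculus acts on an eigenvector through the eigenvalue. -/
theorem cfc_apply_eigenvector {a : H →L[ℂ] H} (ha : IsSelfAdjoint a) {f : ℝ → ℝ}
    (hf : Continuous f) {l : ℝ} {v : H} (hv : a v = (l : ℂ) • v) :
    cfc f a v = (f l : ℂ) • v := by
  have hpow : ∀ n : ℕ, (a ^ n) v = ((l ^ n : ℝ) : ℂ) • v := by
    intro n
    induction n with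
    | zero => simp
    | succ n ih =>
      rw [pow_succ, mul_apply_eq_comp, hv, map_smul, ih, smul_smul]
      congr 1
      push_cast
      ring
  have hpoly : ∀ p : ℝ[X], (aeval a p) v = ((p.eval l : ℝ) : ℂ) • v := by
    intro p
    induction p using Polynomial.induction_on' with
    | add p q hp hq => simp [hp, hq, add_smul]
    | monomial n c =>
      rw [aeval_monomial, Algebra.algebraMap_eq_smul_one, smul_mul_assoc, one_mul,
        ← Complex.coe_smul, _root_.smul_apply, hpow, eval_monomial, smul_smul]
      push_cast
      rfl
  obtain ⟨P, hP1, hP2⟩ := exists_polynomial_tendsto_cfc (A := H →L[ℂ] H) f hf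
  have hev : Continuous fun T : H →L[ℂ] H => T v := by fun_prop
  have h1 := (hev.tendsto _).comp (hP2 a ha)
  have h2 : Tendsto (fun n => (((P n).eval l : ℝ) : ℂ) • v) atTop (𝓝 ((f l : ℂ) • v)) :=
    ((Complex.continuous_ofReal.tendsto _).comp (hP1 l)).smul_const v
  refine tendsto_nhds_unique h1 (h2.congr fun n => ?_)
  rw [Function.comp_apply, hpoly]

/-- A compact positive operator is diagonalized by an orthonormal basis. -/
theorem exists_hilbertBasis_eigenvectors {P : H →L[ℂ] H} (hP : 0 ≤ P) (hc : IsCompactOperator P) :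
    ∃ (κ : Type u) (v : HilbertBasis κ ℂ H) (m : κ → ℝ),
      ∀ k, 0 ≤ m k ∧ P (v k) = (m k : ℂ) • v k := by
  have hpos := (ContinuousLinearMap.nonneg_iff_isPositive P).1 hP
  let T : Module.End ℂ H := P
  have hsym : T.IsSymmetric := hpos.isSymmetric
  have hclosed : ∀ μ, IsClosed (Module.End.eigenspace T μ : Set H) := by
    intro μ
    have : (Module.End.eigenspace T μ : Set H) = {x | P x = μ • x} := by
      ext x; exact Module.End.mem_eigenspace_iff
    rw [this]
    exact isClosed_eq P.continuous (continuous_const_smul μ)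
  have hcomp : ∀ μ, CompleteSpace (Module.End.eigenspace T μ) :=
    fun μ => (hclosed μ).completeSpace_coe
  -- All complex `μ` are taken, the kernel included; the basis is empty when `μ` is not an
  -- eigenvalue.
  choose w b hb using fun μ => exists_hilbertBasis ℂ (Module.End.eigenspace T μ)
  let v : (Σ μ, w μ) → H := fun k => (b k.1 k.2 : H)
  have hv : Orthonormal ℂ v :=
    hsym.orthogonalFamily_eigenspaces.orthonormal_sigma_orthonormal fun μ => (b μ).orthonormal
  have hbot : (Submodule.span ℂ (Set.range v))ᗮ = ⊥ := by
    have h0 := ContinuousLinearMap.orthogonalComplement_iSup_eigenspaces_eq_bot (T := P) hc hsym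
    rw [eq_bot_iff, ← h0]
    intro x hx
    rw [Submodule.mem_orthogonal'] at hx
    rw [← Submodule.iInf_orthogonal, Submodule.mem_iInf]
    intro μ
    rw [Submodule.mem_orthogonal']
    intro y hy
    have h1 := ((b μ).hasSum_repr ⟨y, hy⟩).mapL
      ((innerSL ℂ x).comp (Module.End.eigenspace T μ).subtypeL)
    refine h1.unique ?_
    convert hasSum_zero with i
    have h2 := hx (b μ i) (Submodule.subset_span ⟨⟨μ, i⟩, rfl⟩)
    simp [h2]
  refine ⟨_, HilbertBasis.mkOfOrthogonalEqBot hv hbot, fun k => k.1.re, fun k => ?_⟩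
  rw [HilbertBasis.coe_mkOfOrthogonalEqBot]
  have h1 : P (v k) = k.1 • v k := Module.End.mem_eigenspace_iff.1 (b k.1 k.2).2
  -- Positivity of this number forces the eigenvalue to be real and nonnegative.
  have h2 : ⟪P (v k), v k⟫_ℂ = (starRingEnd ℂ) k.1 := by
    rw [h1, inner_smul_left, inner_self_eq_norm_sq_to_K, hv.1]; simp
  have h3 := (ContinuousLinearMap.isPositive_iff_complex P).1 hpos (v k)
  rw [h2] at h3
  have h4 := Complex.ext_iff.1 h3.1
  simp at h3 h4
  refine ⟨h3.2, ?_⟩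
  rw [h1]
  congr 1
  exact Complex.ext (by simp) (by simp [← h4])

/-- `C = ∑ₖ lₖ ⟨vₖ, ·⟩ uₖ` with orthonormal families `v`, `u` and positive numbers `l`. -/
structure IsSVD (C : H →L[ℂ] H) (v u : κ → H) (l : κ → ℝ) : Prop where
  orthonormal_right : Orthonormal ℂ v
  orthonormal_left : Orthonormal ℂ u
  pos : ∀ k, 0 < l k
  hasSum : ∀ x y, HasSum (fun k => (l k : ℂ) * (⟪y, u k⟫_ℂ * ⟪v k, x⟫_ℂ)) ⟪y, C x⟫_ℂ

/-- The singular value decomposition of a compact operator. -/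
theorem exists_isSVD (e : HilbertBasis ι ℂ H) {C : H →L[ℂ] H} (hC : IsCompactOperator C) :
    ∃ (κ : Type u) (v u : κ → H) (l : κ → ℝ), IsSVD C v u l ∧
      ∀ p : ℝ, 0 < p → posTrace e (CFC.abs C ^ p) = ∑' k, ENNReal.ofReal (l k) ^ p := by
  have hP : 0 ≤ star C * C := star_mul_self_nonneg C
  obtain ⟨κ, w, m, hm⟩ := exists_hilbertBasis_eigenvectors hP (hC.clm_comp (star C))
  let l : κ → ℝ := fun k => √(m k)
  have hl0 : ∀ k, 0 ≤ l k := fun k => Real.sqrt_nonneg _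
  have hl2 : ∀ k, l k * l k = m k := fun k => Real.mul_self_sqrt (hm k).1
  have habs : ∀ k, CFC.abs C (w k) = (l k : ℂ) • w k := by
    intro k
    rw [CFC.abs, CFC.sqrt_eq_real_sqrt _ hP, cfcₙ_eq_cfc]
    exact cfc_apply_eigenvector hP.isSelfAdjoint Real.continuous_sqrt (hm k).2
  have hpow : ∀ p : ℝ, 0 < p → ∀ k, (CFC.abs C ^ p) (w k) = ((l k ^ p : ℝ) : ℂ) • w k := by
    intro p hp k
    rw [CFC.rpow_eq_cfc_real (ha := CFC.abs_nonneg C)]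
    exact cfc_apply_eigenvector (CFC.abs_nonneg C).isSelfAdjoint
      (Real.continuous_rpow_const hp.le) (habs k)
  have hinner : ∀ j k, ⟪C (w j), C (w k)⟫_ℂ = (m k : ℂ) * ⟪w j, w k⟫_ℂ := by
    intro j k
    rw [← ContinuousLinearMap.adjoint_inner_right, ← inner_smul_right, ← (hm k).2]
    rfl
  have hzero : ∀ k, l k = 0 → C (w k) = 0 := by
    intro k hk
    have h := hinner k k
    rw [← hl2, hk] at h
    simpa using h
  -- Dropping the kernel of `C` allows `uₖ = lₖ⁻¹ C wₖ`; these are orthonormal by `hinner`.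
  let K : Set κ := {k | l k ≠ 0}
  have hu : ∀ k : K, C (w k) = (l k : ℂ) • ((l k : ℂ)⁻¹ • C (w k)) := fun k => by
    rw [smul_smul, mul_inv_cancel₀ (by exact_mod_cast k.2), one_smul]
  refine ⟨K, fun k => w k, fun k => (l k : ℂ)⁻¹ • C (w k), fun k => l k, ⟨?_, ?_, ?_, ?_⟩, ?_⟩
  · exact w.orthonormal.comp _ Subtype.val_injective
  · classical
    rw [orthonormal_iff_ite]
    intro j k
    rw [inner_smul_left, inner_smul_right, hinner, orthonormal_iff_ite.1 w.orthonormal, ← hl2]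
    by_cases h : j = k
    · subst h
      have hj : (l j : ℂ) ≠ 0 := by exact_mod_cast j.2
      simp only [if_true]
      rw [map_inv₀, Complex.conj_ofReal]
      push_cast
      field_simp
    · have h' : (j : κ) ≠ k := fun h' => h (Subtype.ext h')
      simp [h, h']
  · exact fun k => lt_of_le_of_ne (hl0 k) (Ne.symm k.2)
  · intro x y
    have h := w.hasSum_inner_mul_inner (C.adjoint y) x
    simp_rw [ContinuousLinearMap.adjoint_inner_left] at h
    have hs : Function.support (fun k => ⟪y, C (w k)⟫_ℂ * ⟪w k, x⟫_ℂ) ⊆ K := by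
      intro k hk hlk
      exact hk (by simp [hzero k hlk])
    rw [← hasSum_subtype_iff_of_support_subset hs] at h
    convert h using 1
    funext k
    change _ = ⟪y, C (w k)⟫_ℂ * ⟪w k, x⟫_ℂ
    conv_rhs => rw [hu k, inner_smul_right]
    rw [mul_assoc]
  · intro p hp
    rw [posTrace_eq_posTrace e w CFC.rpow_nonneg, posTrace]
    have h : ∀ k, ENNReal.ofReal (⟪w k, (CFC.abs C ^ p) (w k)⟫_ℂ).re = ENNReal.ofReal (l k) ^ p := by
      intro k
      rw [hpow p hp, inner_smul_right, inner_self_eq_norm_sq_to_K, w.orthonormal.1,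
        ENNReal.ofReal_rpow_of_nonneg (hl0 k) hp.le]
      simp
    simp_rw [h]
    refine (tsum_subtype_eq_of_support_subset (s := K) ?_).symm
    intro k hk hlk
    rw [Function.mem_support, hlk] at hk
    simp [hp] at hk

/-! ### Inequalities for Schatten norms. -/

/-- Jensen's inequality for `x ↦ x ^ p` and subprobability weights. -/
theorem rpow_tsum_mul_le {c l : κ → ℝ≥0∞} (hc : ∑' k, c k ≤ 1) {p : ℝ} (hp : 1 ≤ p) :
    (∑' k, l k * c k) ^ p ≤ ∑' k, l k ^ p * c k := by
  rcases hp.eq_or_lt with rfl | hp1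
  · simp
  have hp0 : 0 < p := by linarith
  have hpq := Real.HolderConjugate.conjExponent hp1
  set q := p.conjExponent
  let _ : MeasurableSpace κ := ⊤
  -- Hölder for the splitting `l c = (l c^{1/p}) c^{1/q}`; the second factor has norm at most one.
  have h := ENNReal.lintegral_mul_le_Lp_mul_Lq (Measure.count : Measure κ) hpq
    (f := fun k => l k * c k ^ (1 / p)) (g := fun k => c k ^ (1 / q))
    (measurable_from_top).aemeasurable (measurable_from_top).aemeasurable
  simp only [lintegral_count, Pi.mul_apply] at h
  have h1 : ∀ k, l k * c k ^ (1 / p) * c k ^ (1 / q) = l k * c k := by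
    intro k
    rw [mul_assoc, ← ENNReal.rpow_add_of_nonneg _ _ (by positivity) (by have := hpq.symm.pos; positivity)]
    have : 1 / p + 1 / q = 1 := by simpa using hpq.inv_add_inv_eq_one
    rw [this, ENNReal.rpow_one]
  have h2 : ∀ k, (l k * c k ^ (1 / p)) ^ p = l k ^ p * c k := by
    intro k
    rw [ENNReal.mul_rpow_of_nonneg _ _ hp0.le, ← ENNReal.rpow_mul, one_div_mul_cancel hp0.ne',
      ENNReal.rpow_one]
  have h3 : ∀ k, (c k ^ (1 / q)) ^ q = c k := by
    intro k
    rw [← ENNReal.rpow_mul, one_div_mul_cancel hpq.symm.pos.ne', ENNReal.rpow_one]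
  simp_rw [h1, h2, h3] at h
  have h4 : ∑' k, l k * c k ≤ (∑' k, l k ^ p * c k) ^ (1 / p) := by
    refine h.trans (mul_le_of_le_one_right zero_le ?_)
    exact ENNReal.rpow_le_one hc (by have := hpq.symm.pos; positivity)
  calc _ ≤ ((∑' k, l k ^ p * c k) ^ (1 / p)) ^ p := ENNReal.rpow_le_rpow h4 hp0.le
    _ = _ := by rw [← ENNReal.rpow_mul, one_div_mul_cancel hp0.ne', ENNReal.rpow_one]

/-- Minkowski's inequality for sums in `[0, ∞]`. -/
theorem rpow_tsum_add_le (a b : κ → ℝ≥0∞) {p : ℝ} (hp : 1 ≤ p) :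
    (∑' k, (a k + b k) ^ p) ^ (1 / p) ≤
      (∑' k, a k ^ p) ^ (1 / p) + (∑' k, b k ^ p) ^ (1 / p) := by
  let _ : MeasurableSpace κ := ⊤
  have h := ENNReal.lintegral_Lp_add_le (μ := (Measure.count : Measure κ)) (f := a) (g := b)
    (measurable_from_top).aemeasurable (measurable_from_top).aemeasurable hp
  simpa [lintegral_count] using h

theorem enorm_mul_enorm_le (z w : ℂ) :
    ‖z‖ₑ * ‖w‖ₑ ≤ 2⁻¹ * (‖z‖ₑ ^ 2 + ‖w‖ₑ ^ 2) := by
  have h : 2 * (‖z‖ₑ * ‖w‖ₑ) ≤ ‖z‖ₑ ^ 2 + ‖w‖ₑ ^ 2 := by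
    simp only [enorm_eq_nnnorm]
    norm_cast
    rw [← mul_assoc]
    exact two_mul_le_add_sq _ _
  rw [← ENNReal.div_eq_inv_mul, ENNReal.le_div_iff_mul_le (by simp) (by simp), mul_comm]
  exact h

theorem enorm_inner_symm (x y : H) : ‖⟪x, y⟫_ℂ‖ₑ = ‖⟪y, x⟫_ℂ‖ₑ := by
  rw [← ofReal_norm, ← ofReal_norm, norm_inner_symm]

theorem inv_two_mul_add_le_one {a b : ℝ≥0∞} (ha : a ≤ 1) (hb : b ≤ 1) : 2⁻¹ * (a + b) ≤ 1 := by
  calc 2⁻¹ * (a + b) ≤ 2⁻¹ * (1 + 1) := by gcongr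
    _ = 1 := by rw [one_add_one_eq_two]; exact ENNReal.inv_mul_cancel (by simp) (by simp)

/-- The `p`-th powers of the diagonal entries of an operator with respect to two orthonormal
families are dominated by the `p`-th powers of the singular values. -/
theorem IsSVD.tsum_enorm_inner_rpow_le {A : H →L[ℂ] H} {v u : κ → H} {l : κ → ℝ}
    (hA : IsSVD A v u l) {x y : ι → H} (hx : Orthonormal ℂ x) (hy : Orthonormal ℂ y) {p : ℝ}
    (hp : 1 ≤ p) : ∑' i, ‖⟪x i, A (y i)⟫_ℂ‖ₑ ^ p ≤ ∑' k, ENNReal.ofReal (l k) ^ p := by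
  -- By AM–GM `c i k` dominates `|⟨xᵢ, uₖ⟩ ⟨vₖ, yᵢ⟩|`. Bessel bounds the sums over `k` by
  -- orthonormality of `u`, `v`, and those over `i` by that of `x`, `y`.
  let c : ι → κ → ℝ≥0∞ := fun i k => 2⁻¹ * (‖⟪u k, x i⟫_ℂ‖ₑ ^ 2 + ‖⟪v k, y i⟫_ℂ‖ₑ ^ 2)
  have henorm : ∀ {z : H}, ‖z‖ = 1 → ‖z‖ₑ = 1 := fun {z} hz => by
    rw [← ofReal_norm, hz, ENNReal.ofReal_one]
  have hc1 : ∀ i, ∑' k, c i k ≤ 1 := by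
    intro i
    have h1 := tsum_enorm_inner_sq_le hA.orthonormal_left (x i)
    have h2 := tsum_enorm_inner_sq_le hA.orthonormal_right (y i)
    rw [henorm (hx.1 i), one_pow] at h1
    rw [henorm (hy.1 i), one_pow] at h2
    rw [ENNReal.tsum_mul_left, ENNReal.tsum_add]
    exact inv_two_mul_add_le_one h1 h2
  have hc2 : ∀ k, ∑' i, c i k ≤ 1 := by
    intro k
    have h1 := tsum_enorm_inner_sq_le hx (u k)
    have h2 := tsum_enorm_inner_sq_le hy (v k)
    rw [henorm (hA.orthonormal_left.1 k), one_pow] at h1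
    rw [henorm (hA.orthonormal_right.1 k), one_pow] at h2
    simp_rw [enorm_inner_symm (x _)] at h1
    simp_rw [enorm_inner_symm (y _)] at h2
    rw [ENNReal.tsum_mul_left, ENNReal.tsum_add]
    exact inv_two_mul_add_le_one h1 h2
  have h1 : ∀ i, ‖⟪x i, A (y i)⟫_ℂ‖ₑ ≤ ∑' k, ENNReal.ofReal (l k) * c i k := by
    intro i
    rw [← (hA.hasSum (y i) (x i)).tsum_eq]
    refine (enorm_tsum_le_tsum_enorm).trans (ENNReal.tsum_le_tsum fun k => ?_)
    rw [enorm_mul, enorm_mul, ← ofReal_norm (l k : ℂ), Complex.norm_of_nonneg (hA.pos k).le,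
      enorm_inner_symm (x i)]
    gcongr
    exact enorm_mul_enorm_le _ _
  calc ∑' i, ‖⟪x i, A (y i)⟫_ℂ‖ₑ ^ p
      ≤ ∑' i, ∑' k, ENNReal.ofReal (l k) ^ p * c i k :=
        ENNReal.tsum_le_tsum fun i => (ENNReal.rpow_le_rpow (h1 i) (by linarith)).trans
          (rpow_tsum_mul_le (hc1 i) hp)
    _ = ∑' k, ENNReal.ofReal (l k) ^ p * ∑' i, c i k := by
        rw [ENNReal.tsum_comm]; simp_rw [ENNReal.tsum_mul_left]
    _ ≤ ∑' k, ENNReal.ofReal (l k) ^ p :=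
        ENNReal.tsum_le_tsum fun k => mul_le_of_le_one_right zero_le (hc2 k)

/-- Exhibits a singular value as a quantity linear in the operator, which lets a sum be split. -/
theorem IsSVD.inner_eq {C : H →L[ℂ] H} {v u : κ → H} {l : κ → ℝ} (hC : IsSVD C v u l) (k : κ) :
    ⟪u k, C (v k)⟫_ℂ = l k := by
  classical
  have h := hC.hasSum (v k) (u k)
  simp_rw [orthonormal_iff_ite.1 hC.orthonormal_left, orthonormal_iff_ite.1 hC.orthonormal_right]
    at h
  refine h.unique ?_
  convert hasSum_ite_eq k (l k : ℂ) using 2 with j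
  by_cases hj : j = k
  · simp [hj]
  · simp [hj, Ne.symm hj]

/-- The triangle inequality for the Schatten norms of compact operators. -/
theorem schattenNorm_add_le (e : HilbertBasis ι ℂ H) {A B : H →L[ℂ] H} (hA : IsCompactOperator A)
    (hB : IsCompactOperator B) {p : ℝ} (hp : 1 ≤ p) :
    schattenNorm e p (A + B) ≤ schattenNorm e p A + schattenNorm e p B := by
  have hp0 : 0 < p := by linarith
  obtain ⟨_, _, _, a, hsA, hpA⟩ := exists_isSVD e hA
  obtain ⟨_, _, _, b, hsB, hpB⟩ := exists_isSVD e hB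
  obtain ⟨_, v, u, l, hsC, hpC⟩ := exists_isSVD (C := A + B) e (hA.add hB)
  unfold schattenNorm
  rw [hpA p hp0, hpB p hp0, hpC p hp0]
  have h1 : ∀ k, ENNReal.ofReal (l k) ≤ ‖⟪u k, A (v k)⟫_ℂ‖ₑ + ‖⟪u k, B (v k)⟫_ℂ‖ₑ := by
    intro k
    rw [← Complex.norm_of_nonneg (hsC.pos k).le, ofReal_norm, ← hsC.inner_eq k, _root_.add_apply,
      inner_add_right]
    exact enorm_add_le _ _
  calc _ ≤ (∑' k, (‖⟪u k, A (v k)⟫_ℂ‖ₑ + ‖⟪u k, B (v k)⟫_ℂ‖ₑ) ^ p) ^ (1 / p) := by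
        gcongr with k; exact h1 k
    _ ≤ _ := rpow_tsum_add_le _ _ hp
    _ ≤ _ := by
        gcongr
        · exact hsA.tsum_enorm_inner_rpow_le hsC.orthonormal_left hsC.orthonormal_right hp
        · exact hsB.tsum_enorm_inner_rpow_le hsC.orthonormal_left hsC.orthonormal_right hp

/-- The Schatten norms of a compact operator decrease in the exponent. -/
theorem schattenNorm_anti (e : HilbertBasis ι ℂ H) {C : H →L[ℂ] H} (hC : IsCompactOperator C)
    {p r : ℝ} (hr : 1 ≤ r) (hrp : r ≤ p) : schattenNorm e p C ≤ schattenNorm e r C := by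
  have hr0 : 0 < r := by linarith
  have hp0 : 0 < p := by linarith
  obtain ⟨_, v, u, l, -, hl⟩ := exists_isSVD e hC
  unfold schattenNorm
  rw [hl p hp0, hl r hr0]
  set M := (∑' k, ENNReal.ofReal (l k) ^ r) ^ (1 / r) with hM
  have hMr : M ^ r = ∑' k, ENNReal.ofReal (l k) ^ r := by
    rw [hM, ← ENNReal.rpow_mul, one_div_mul_cancel hr0.ne', ENNReal.rpow_one]
  have h1 : ∀ k, ENNReal.ofReal (l k) ≤ M := by
    intro k
    rw [← ENNReal.rpow_le_rpow_iff hr0, hMr]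
    exact ENNReal.le_tsum k
  have h2 : ∑' k, ENNReal.ofReal (l k) ^ p ≤ M ^ p := by
    -- Each singular value is at most the `ℓ^r` norm `M`, so `l^p = l^{p-r} l^r ≤ M^{p-r} l^r`.
    have hsplit : ∀ a : ℝ≥0∞, a ^ p = a ^ (p - r) * a ^ r := by
      intro a
      rw [← ENNReal.rpow_add_of_nonneg _ _ (by linarith) hr0.le, sub_add_cancel]
    rw [hsplit M, hMr, ← ENNReal.tsum_mul_left]
    refine ENNReal.tsum_le_tsum fun k => ?_
    rw [hsplit]
    gcongr
    exact h1 k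
  calc _ ≤ (M ^ p) ^ (1 / p) := by gcongr
    _ = M := by rw [← ENNReal.rpow_mul, mul_one_div_cancel hp0.ne', ENNReal.rpow_one]

theorem posTrace_smul (e : HilbertBasis ι ℂ H) {c : ℝ} (hc : 0 ≤ c) (A : H →L[ℂ] H) :
    posTrace e (c • A) = ENNReal.ofReal c * posTrace e A := by
  unfold posTrace
  rw [← ENNReal.tsum_mul_left]
  refine tsum_congr fun i => ?_
  rw [← ENNReal.ofReal_mul hc, ← Complex.coe_smul, _root_.smul_apply, inner_smul_right,
    Complex.re_ofReal_mul]

theorem smul_rpow_of_nonneg {P : H →L[ℂ] H} (hP : 0 ≤ P) {c p : ℝ} (hc : 0 ≤ c) (hp : 0 ≤ p) :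
    (c • P) ^ p = c ^ p • P ^ p := by
  have hcP : 0 ≤ c • P := smul_nonneg hc hP
  rw [CFC.rpow_eq_cfc_real (ha := hcP), CFC.rpow_eq_cfc_real (ha := hP)]
  rw [← cfc_comp_smul c (fun x : ℝ => x ^ p) P (Real.continuous_rpow_const hp).continuousOn
    hP.isSelfAdjoint, ← cfc_smul (c ^ p) (fun x : ℝ => x ^ p) P (Real.continuous_rpow_const hp).continuousOn]
  refine cfc_congr fun x hx => ?_
  simp only [smul_eq_mul]
  rw [Real.mul_rpow hc (spectrum_nonneg_of_nonneg hP hx)]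

theorem schattenNorm_smul (e : HilbertBasis ι ℂ H) (c : ℂ) (A : H →L[ℂ] H) {p : ℝ} (hp : 1 ≤ p) :
    schattenNorm e p (c • A) = ‖c‖ₑ * schattenNorm e p A := by
  have hp0 : 0 < p := by linarith
  unfold schattenNorm
  rw [CFC.abs_smul, smul_rpow_of_nonneg (CFC.abs_nonneg A) (norm_nonneg c) hp0.le,
    posTrace_smul e (by positivity), ENNReal.mul_rpow_of_nonneg _ _ (by positivity),
    ← ENNReal.ofReal_rpow_of_nonneg (norm_nonneg c) hp0.le, ← ENNReal.rpow_mul,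
    mul_one_div_cancel hp0.ne', ENNReal.rpow_one, ofReal_norm]

theorem schattenNorm_one_of_nonneg (e : HilbertBasis ι ℂ H) {A : H →L[ℂ] H} (hA : 0 ≤ A) :
    schattenNorm e 1 A = posTrace e A := by
  rw [schattenNorm, CFC.abs_of_nonneg A hA, CFC.rpow_one A hA, one_div_one, ENNReal.rpow_one]

/-! ### Traces against density operators. -/

theorem summable_norm_sqrt_sq (e : HilbertBasis ι ℂ H) {s : H →L[ℂ] H} (hs : s ∈ states e) :
    Summable fun i => ‖CFC.sqrt s (e i)‖ ^ 2 := by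
  have h2 : ∑' i, ‖CFC.sqrt s (e i)‖ₑ ^ 2 ≠ ∞ := by
    rw [← posTrace_eq_tsum_sqrt e hs.1, hs.2]; simp
  refine (ENNReal.summable_toReal h2).congr fun i => ?_
  rw [ENNReal.toReal_pow, toReal_enorm]

/-- Cyclicity of the trace: `tr(s A) = tr(s^{1/2} A s^{1/2})` for a density operator `s`. -/
theorem trace_state_mul (e : HilbertBasis ι ℂ H) {s A : H →L[ℂ] H} (hs : s ∈ states e)
    (hA : IsSelfAdjoint A) :
    trace e (s * A) = ∑' j, ⟪e j, (CFC.sqrt s * A * CFC.sqrt s) (e j)⟫_ℂ := by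
  have hBB := CFC.sqrt_mul_sqrt_self s hs.1
  have hBsymm := inner_sqrt_left s
  have hBsum := summable_norm_sqrt_sq e hs
  set B : H →L[ℂ] H := CFC.sqrt s with hB
  have hAsymm : ∀ x y : H, ⟪A x, y⟫_ℂ = ⟪x, A y⟫_ℂ := fun x y => hA.isSymmetric x y
  have hABsum : Summable fun i => ‖A (B (e i))‖ ^ 2 := by
    refine Summable.of_nonneg_of_le (fun i => by positivity) (fun i => ?_)
      (hBsum.mul_left (‖A‖ ^ 2))
    rw [← mul_pow]
    gcongr
    exact A.le_opNorm _
  have hP1 : Summable fun x : ι × ι => ‖⟪e x.2, B (e x.1)⟫_ℂ‖ ^ 2 := by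
    rw [summable_prod_of_nonneg (fun x => by positivity)]
    exact ⟨fun i => (hasSum_norm_inner_sq e (B (e i))).summable,
      hBsum.congr fun i => (hasSum_norm_inner_sq e (B (e i))).tsum_eq.symm⟩
  have hP2 : Summable fun x : ι × ι => ‖⟪e x.1, A (B (e x.2))⟫_ℂ‖ ^ 2 := by
    have : Summable fun x : ι × ι => ‖⟪e x.2, A (B (e x.1))⟫_ℂ‖ ^ 2 := by
      rw [summable_prod_of_nonneg (fun x => by positivity)]
      exact ⟨fun i => (hasSum_norm_inner_sq e (A (B (e i)))).summable,
        hABsum.congr fun i => (hasSum_norm_inner_sq e (A (B (e i)))).tsum_eq.symm⟩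
    exact this.prod_symm
  have hswap : ∀ i j, ⟪e j, B (A (e i))⟫_ℂ = ⟪A (B (e j)), e i⟫_ℂ := by
    intro i j
    rw [hAsymm, hBsymm]
  -- The entries of the Hilbert–Schmidt operators `B` and `A B` are square summable, so their
  -- products are absolutely summable and the double sum may be exchanged.
  have hF : Summable (Function.uncurry
      fun i j : ι => ⟪B (e i), e j⟫_ℂ * ⟪e j, B (A (e i))⟫_ℂ) := by
    refine Summable.of_norm_bounded (hP1.add hP2) ?_
    rintro ⟨i, j⟩
    simp only [Function.uncurry, norm_mul]
    rw [hswap, norm_inner_symm (B (e i)), norm_inner_symm (A (B (e j)))]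
    nlinarith [sq_nonneg (‖⟪e j, B (e i)⟫_ℂ‖ - ‖⟪e i, A (B (e j))⟫_ℂ‖),
      sq_nonneg (‖⟪e j, B (e i)⟫_ℂ‖), sq_nonneg ‖⟪e i, A (B (e j))⟫_ℂ‖]
  have h1 : ∀ i, ⟪e i, (s * A) (e i)⟫_ℂ = ∑' j, ⟪B (e i), e j⟫_ℂ * ⟪e j, B (A (e i))⟫_ℂ := by
    intro i
    rw [(e.hasSum_inner_mul_inner _ _).tsum_eq, hBsymm, ← hBB]
    rfl
  unfold trace
  rw [tsum_congr h1, ← hF.tsum_comm]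
  refine tsum_congr fun j => ?_
  rw [mul_apply_eq_comp, mul_apply_eq_comp, ← hBsymm, ← hAsymm,
    ← (e.hasSum_inner_mul_inner (A (B (e j))) (B (e j))).tsum_eq]
  refine tsum_congr fun i => ?_
  rw [hswap, hBsymm, mul_comm]

theorem sqrt_conj_nonneg (s : H →L[ℂ] H) {A : H →L[ℂ] H} (hA : 0 ≤ A) :
    0 ≤ CFC.sqrt s * A * CFC.sqrt s := by
  have h := star_left_conjugate_nonneg hA (CFC.sqrt s)
  rwa [(CFC.sqrt_nonneg s).isSelfAdjoint.star_eq] at h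

theorem enorm_trace_state_mul (e : HilbertBasis ι ℂ H) {s A : H →L[ℂ] H} (hs : s ∈ states e)
    (hA : 0 ≤ A) : ‖trace e (s * A)‖ₑ = posTrace e (CFC.sqrt s * A * CFC.sqrt s) := by
  have hpos := (ContinuousLinearMap.nonneg_iff_isPositive _).1 (sqrt_conj_nonneg s hA)
  rw [trace_state_mul e hs hA.isSelfAdjoint, posTrace]
  set z : ι → ℂ := fun j => ⟪e j, (CFC.sqrt s * A * CFC.sqrt s) (e j)⟫_ℂ with hz
  have hz0 : ∀ j, 0 ≤ (z j).re := fun j => hpos.re_inner_nonneg_right (e j)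
  have hzr : ∀ j, z j = ((z j).re : ℂ) := fun j => by
    have h := ((ContinuousLinearMap.isPositive_iff_complex _).1 hpos (e j)).1
    have h2 : z j = ⟪(CFC.sqrt s * A * CFC.sqrt s) (e j), e j⟫_ℂ := (hpos.isSymmetric _ _).symm
    rw [h2]; exact h.symm
  -- Needed because a divergent `tsum` in `ℂ` would be zero; the terms are at most `‖A‖ ‖s^{1/2}
  -- eⱼ‖²`.
  have hsum : Summable fun j => (z j).re := by
    refine Summable.of_nonneg_of_le hz0 (fun j => ?_)
      ((summable_norm_sqrt_sq e hs).mul_left ‖A‖)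
    have h1 : z j = ⟪CFC.sqrt s (e j), A (CFC.sqrt s (e j))⟫_ℂ := (inner_sqrt_left s _ _).symm
    calc (z j).re ≤ ‖z j‖ := Complex.re_le_norm _
      _ ≤ ‖CFC.sqrt s (e j)‖ * (‖A‖ * ‖CFC.sqrt s (e j)‖) := by
          rw [h1]
          exact (norm_inner_le_norm _ _).trans (by gcongr; exact A.le_opNorm _)
      _ = _ := by ring
  have h1 : ∑' j, z j = ((∑' j, (z j).re : ℝ) : ℂ) := by
    rw [Complex.ofReal_tsum]
    exact tsum_congr hzr
  rw [h1, ← ofReal_norm, Complex.norm_of_nonneg (tsum_nonneg hz0),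
    ENNReal.ofReal_tsum_of_nonneg hz0 hsum]

theorem posTrace_add (e : HilbertBasis ι ℂ H) {A B : H →L[ℂ] H} (hA : 0 ≤ A) (hB : 0 ≤ B) :
    posTrace e (A + B) = posTrace e A + posTrace e B := by
  unfold posTrace
  rw [← ENNReal.tsum_add]
  refine tsum_congr fun i => ?_
  rw [_root_.add_apply, inner_add_right, Complex.add_re, ENNReal.ofReal_add]
  · exact ((ContinuousLinearMap.nonneg_iff_isPositive _).1 hA).re_inner_nonneg_right (e i)
  · exact ((ContinuousLinearMap.nonneg_iff_isPositive _).1 hB).re_inner_nonneg_right (e i)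

/-! ### Vector states and measurability of quantum random variables. -/

theorem rankOne_mem_states (e : HilbertBasis ι ℂ H) {v : H} (hv : ‖v‖ = 1) :
    InnerProductSpace.rankOne ℂ v v ∈ states e := by
  refine ⟨(ContinuousLinearMap.nonneg_iff_isPositive _).2
    (InnerProductSpace.isPositive_rankOne_self v), ?_⟩
  have h := tsum_enorm_inner_sq e v
  rw [← ofReal_norm, hv, ENNReal.ofReal_one, one_pow] at h
  rw [← h]
  refine tsum_congr fun i => ?_
  rw [InnerProductSpace.rankOne_apply, inner_smul_right, ← inner_conj_symm v, Complex.conj_mul',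
    ← ofReal_norm, ← ENNReal.ofReal_pow (norm_nonneg _)]
  norm_cast

theorem trace_rankOne_mul (e : HilbertBasis ι ℂ H) (v : H) (T : H →L[ℂ] H) :
    trace e (InnerProductSpace.rankOne ℂ v v * T) = ⟪v, T v⟫_ℂ := by
  rw [← ContinuousLinearMap.adjoint_inner_left, ← e.tsum_inner_mul_inner]
  refine tsum_congr fun i => ?_
  rw [mul_apply_eq_comp, InnerProductSpace.rankOne_apply, inner_smul_right,
    ContinuousLinearMap.adjoint_inner_left]

/-- Vector states give the diagonal coefficients at unit vectors, scaling gives them at all vectors,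
and polarization gives the rest. -/
theorem IsQuantumRV.weaklyMeasurable {e : HilbertBasis ι ℂ H} {f : X → H →L[ℂ] H}
    (hf : IsQuantumRV e f) : WeaklyMeasurable f := by
  have hdiag : ∀ u, Measurable fun x => ⟪f x u, u⟫_ℂ := by
    intro u
    rcases eq_or_ne u 0 with rfl | hu
    · simp
    have hu' : ‖u‖ ≠ 0 := norm_ne_zero_iff.2 hu
    let v : H := ((‖u‖⁻¹ : ℝ) : ℂ) • u
    have hv : ‖v‖ = 1 := by
      rw [norm_smul, Complex.norm_real, norm_inv, norm_norm, inv_mul_cancel₀ hu']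
    have huv : u = (‖u‖ : ℂ) • v := by
      rw [smul_smul, ← Complex.ofReal_mul, mul_inv_cancel₀ hu', Complex.ofReal_one, one_smul]
    have h1 := hf _ (rankOne_mem_states e hv)
    simp_rw [trace_rankOne_mul] at h1
    have h2 : ∀ x, ⟪f x u, u⟫_ℂ = (‖u‖ : ℂ) * ((‖u‖ : ℂ) * (starRingEnd ℂ) ⟪v, f x v⟫_ℂ) := by
      intro x
      conv_lhs => rw [huv, map_smul, inner_smul_left, inner_smul_right, Complex.conj_ofReal]
      rw [inner_conj_symm]
    simp_rw [h2]
    exact ((Complex.continuous_conj.measurable.comp h1).const_mul _).const_mul _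
  intro u v
  have h : ∀ x, ⟪u, f x v⟫_ℂ = (starRingEnd ℂ) ⟪f x v, u⟫_ℂ := fun x => (inner_conj_symm _ _).symm
  simp_rw [h]
  refine Complex.continuous_conj.measurable.comp ?_
  have hpol := fun x => inner_map_polarization (f x : H →ₗ[ℂ] H) u v
  simp only [ContinuousLinearMap.coe_coe] at hpol
  simp_rw [hpol]
  exact (((hdiag _).sub (hdiag _)).add ((hdiag _).const_mul _)).sub ((hdiag _).const_mul _)
    |>.div_const _

theorem weaklyMeasurable_of_mem_quantumSpan {e : HilbertBasis ι ℂ H} {f : X → H →L[ℂ] H}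
    (hf : f ∈ quantumSpan X e) : WeaklyMeasurable f := by
  unfold quantumSpan at hf
  induction hf using Submodule.span_induction with
  | mem f hf => exact hf.1.weaklyMeasurable
  | zero => exact WeaklyMeasurable.const 0
  | add f g _ _ hf hg => exact WeaklyMeasurable.add hf hg
  | smul c f _ hf => exact WeaklyMeasurable.smul c hf

/-! ### The integrated norms. -/

theorem sandwich_add (D f g : X → H →L[ℂ] H) (x : X) :
    sandwich D (f + g) x = sandwich D f x + sandwich D g x := by
  simp only [sandwich, Pi.add_apply, mul_add, add_mul]

theorem sandwich_smul (D f : X → H →L[ℂ] H) (c : ℂ) (x : X) :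
    sandwich D (c • f) x = c • sandwich D f x := by
  simp only [sandwich, Pi.smul_apply, mul_smul_comm, smul_mul_assoc]

theorem WeaklyMeasurable.state_sandwich [TopologicalSpace.SeparableSpace H]
    {D f : X → H →L[ℂ] H} (hD : WeaklyMeasurable D) (hf : WeaklyMeasurable f) (s : H →L[ℂ] H) :
    WeaklyMeasurable fun x => CFC.sqrt s * sandwich D f x * CFC.sqrt s :=
  ((const _).mul ((hD.sqrt.mul hf).mul hD.sqrt)).mul (const _)

theorem isCompactOperator_state_conj (e : HilbertBasis ι ℂ H) {s : H →L[ℂ] H} (hs : s ∈ states e)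
    (A : H →L[ℂ] H) : IsCompactOperator (CFC.sqrt s * A * CFC.sqrt s : H →L[ℂ] H) :=
  (isCompactOperator_sqrt e hs.1 (by rw [hs.2]; simp)).clm_comp (CFC.sqrt s * A)

theorem schattenLNorm_smul (e : HilbertBasis ι ℂ H) (μ : Measure X) (D f : X → H →L[ℂ] H) (c : ℂ)
    {p q : ℝ} (hp : 1 ≤ p) (hq : 1 ≤ q) :
    schattenLNorm e μ D p q (c • f) = ‖c‖ₑ * schattenLNorm e μ D p q f := by
  have hq0 : 0 < q := by linarith
  unfold schattenLNorm
  simp_rw [ENNReal.mul_iSup]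
  refine iSup_congr fun s => iSup_congr fun hs => ?_
  simp_rw [sandwich_smul, mul_smul_comm, smul_mul_assoc, schattenNorm_smul e c _ hp,
    ENNReal.mul_rpow_of_nonneg _ _ hq0.le]
  -- The constant is finite, so it leaves the integral without measurability of the integrand.
  rw [lintegral_const_mul' _ _ (ENNReal.rpow_ne_top_of_nonneg hq0.le enorm_ne_top),
    ENNReal.mul_rpow_of_nonneg _ _ (by positivity), ← ENNReal.rpow_mul,
    mul_one_div_cancel hq0.ne', ENNReal.rpow_one]

theorem schattenLNorm_add_le [TopologicalSpace.SeparableSpace H] (e : HilbertBasis ι ℂ H)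
    (μ : Measure X) {D f g : X → H →L[ℂ] H} (hD : WeaklyMeasurable D) (hf : WeaklyMeasurable f)
    (hg : WeaklyMeasurable g) {p q : ℝ} (hp : 1 ≤ p) (hq : 1 ≤ q) :
    schattenLNorm e μ D p q (f + g) ≤ schattenLNorm e μ D p q f + schattenLNorm e μ D p q g := by
  have hp0 : 0 ≤ p := by linarith
  refine iSup₂_le fun s hs => ?_
  refine le_trans ?_ (add_le_add (le_iSup₂ (f := fun s (_ : s ∈ states e) =>
      (∫⁻ x, schattenNorm e p (CFC.sqrt s * sandwich D f x * CFC.sqrt s) ^ q ∂μ) ^ (1 / q)) s hs)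
    (le_iSup₂ (f := fun s (_ : s ∈ states e) =>
      (∫⁻ x, schattenNorm e p (CFC.sqrt s * sandwich D g x * CFC.sqrt s) ^ q ∂μ) ^ (1 / q)) s hs))
  refine le_trans ?_ (ENNReal.lintegral_Lp_add_le
    ((hD.state_sandwich hf s).schattenNorm e hp0).aemeasurable
    ((hD.state_sandwich hg s).schattenNorm e hp0).aemeasurable hq)
  gcongr with x
  rw [sandwich_add, mul_add, add_mul]
  exact schattenNorm_add_le e (isCompactOperator_state_conj e hs _)
    (isCompactOperator_state_conj e hs _) hp

theorem schattenLNorm_anti (e : HilbertBasis ι ℂ H) (μ : Measure X) (D f : X → H →L[ℂ] H)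
    {p r q : ℝ} (hr : 1 ≤ r) (hrp : r ≤ p) (hq : 1 ≤ q) :
    schattenLNorm e μ D p q f ≤ schattenLNorm e μ D r q f := by
  refine iSup₂_mono fun s hs => ?_
  gcongr with x
  exact schattenNorm_anti e (isCompactOperator_state_conj e hs _) hr hrp

/-- For each decomposition and each state the integrands are already ordered pointwise: the
coefficients `1, -1, i, -i` have modulus one, so the trace norm is at most the sum of the four
traces. -/
theorem schattenLNorm_one_le_qNorm (e : HilbertBasis ι ℂ H) (μ : Measure X)
    (D f : X → H →L[ℂ] H) {q : ℝ} (hq : 1 ≤ q) :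
    schattenLNorm e μ D 1 q f ≤ qNorm e μ D q f := by
  refine le_iInf₂ fun g hg => iSup₂_mono fun s hs => ?_
  gcongr with x
  obtain ⟨hg0, rfl⟩ := hg
  have hsand : ∀ k, 0 ≤ sandwich D (g k) x := fun k => sqrt_conj_nonneg (D x) ((hg0 k).2 x)
  let c : Fin 4 → H →L[ℂ] H := fun k => CFC.sqrt s * sandwich D (g k) x * CFC.sqrt s
  have hc0 : ∀ k, 0 ≤ c k := fun k => sqrt_conj_nonneg s (hsand k)
  have hcc : ∀ k, IsCompactOperator (c k) := fun k => isCompactOperator_state_conj e hs _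
  have h1 : CFC.sqrt s * sandwich D (g 0 - g 1 + Complex.I • g 2 - Complex.I • g 3) x * CFC.sqrt s =
      c 0 + (-1 : ℂ) • c 1 + Complex.I • c 2 + (-Complex.I) • c 3 := by
    have : g 0 - g 1 + Complex.I • g 2 - Complex.I • g 3 =
        g 0 + (-1 : ℂ) • g 1 + Complex.I • g 2 + (-Complex.I) • g 3 := by
      simp only [neg_smul, one_smul, sub_eq_add_neg]
    rw [this]
    simp only [sandwich_add, sandwich_smul, mul_add, add_mul, mul_smul_comm, smul_mul_assoc, c]
  have h2 : ‖stateFun e D s (g 0 + g 1 + g 2 + g 3) x‖ₑ =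
      posTrace e (c 0) + posTrace e (c 1) + posTrace e (c 2) + posTrace e (c 3) := by
    have h3 : CFC.sqrt s * sandwich D (g 0 + g 1 + g 2 + g 3) x * CFC.sqrt s =
        c 0 + c 1 + c 2 + c 3 := by
      simp only [sandwich_add, mul_add, add_mul, c]
    have h4 : 0 ≤ sandwich D (g 0 + g 1 + g 2 + g 3) x := by
      simp only [sandwich_add]
      exact add_nonneg (add_nonneg (add_nonneg (hsand 0) (hsand 1)) (hsand 2)) (hsand 3)
    rw [stateFun, enorm_trace_state_mul e hs h4, h3,
      posTrace_add e (add_nonneg (add_nonneg (hc0 0) (hc0 1)) (hc0 2)) (hc0 3),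
      posTrace_add e (add_nonneg (hc0 0) (hc0 1)) (hc0 2), posTrace_add e (hc0 0) (hc0 1)]
  have hsm : ∀ (a : ℂ) k, ‖a‖ = 1 → schattenNorm e 1 (a • c k) = posTrace e (c k) := by
    intro a k ha
    rw [schattenNorm_smul e a _ le_rfl, schattenNorm_one_of_nonneg e (hc0 k), ← ofReal_norm, ha,
      ENNReal.ofReal_one, one_mul]
  have hcs : ∀ (a : ℂ) k, IsCompactOperator (a • c k : H →L[ℂ] H) := fun a k => (hcc k).smul a
  rw [h1, h2]
  refine (schattenNorm_add_le e (((hcc 0).add (hcs _ 1)).add (hcs _ 2)) (hcs _ 3) le_rfl).trans ?_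
  rw [hsm _ 3 (by simp)]
  gcongr
  refine (schattenNorm_add_le e ((hcc 0).add (hcs _ 1)) (hcs _ 2) le_rfl).trans ?_
  rw [hsm _ 2 (by simp)]
  gcongr
  refine (schattenNorm_add_le e (hcc 0) (hcs _ 1) le_rfl).trans ?_
  rw [hsm _ 1 (by simp), schattenNorm_one_of_nonneg e (hc0 0)]

theorem isSeminormOn_schattenLNorm [TopologicalSpace.SeparableSpace H] (e : HilbertBasis ι ℂ H)
    (μ : Measure X) {D : X → H →L[ℂ] H} (hD : WeaklyMeasurable D) {p q : ℝ} (hp : 1 ≤ p)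
    (hq : 1 ≤ q) : IsSeminormOn (quantumSpan X e) (schattenLNorm e μ D p q) where
  -- Homogeneity with scalar zero, where `0 · ∞ = 0`.
  map_zero := by simpa using schattenLNorm_smul e μ D 0 0 hp hq
  smul c f _ := schattenLNorm_smul e μ D f c hp hq
  add_le _ hf _ hg := schattenLNorm_add_le e μ hD (weaklyMeasurable_of_mem_quantumSpan hf)
    (weaklyMeasurable_of_mem_quantumSpan hg) hp hq

end

end OpLp

theorem mainTheorem11
    {H : Type*} [NormedAddCommGroup H] [InnerProductSpace ℂ H] [CompleteSpace H]
    [TopologicalSpace.SeparableSpace H]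
    {ι : Type*} (e : HilbertBasis ι ℂ H)
    {X : Type*} [TopologicalSpace X] [LocallyCompactSpace X] [T2Space X]
    [MeasurableSpace X] [BorelSpace X]
    (ν : OpLp.POVM X e)
    (ρ : H →L[ℂ] H) (hρ : ρ ∈ OpLp.states e) (hρ_full : Function.Injective ρ)
    (D : X → H →L[ℂ] H) (hD : OpLp.IsRNDeriv ν hρ D) :
    (∀ p q : ℝ, 1 ≤ p → 1 ≤ q →
      OpLp.IsSeminormOn (OpLp.quantumSpan X e)
        (OpLp.schattenLNorm e (OpLp.scalarMeasure ν hρ) D p q)) ∧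
    (∀ p r q : ℝ, 1 ≤ r → r ≤ p → 1 ≤ q → ∀ f ∈ OpLp.quantumSpan X e,
      OpLp.schattenLNorm e (OpLp.scalarMeasure ν hρ) D p q f ≤
        OpLp.schattenLNorm e (OpLp.scalarMeasure ν hρ) D r q f) ∧
    (∀ q : ℝ, 1 ≤ q → ∀ f ∈ OpLp.quantumSpan X e,
      OpLp.schattenLNorm e (OpLp.scalarMeasure ν hρ) D 1 q f ≤
        OpLp.qNorm e (OpLp.scalarMeasure ν hρ) D q f) := by
  have hDm := hD.isQuantumRV.weaklyMeasurable
  exact ⟨fun p q hp hq => OpLp.isSeminormOn_schattenLNorm e _ hDm hp hq,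
    fun p r q hr hrp hq f _ => OpLp.schattenLNorm_anti e _ D f hr hrp hq,
    fun q hq f _ => OpLp.schattenLNorm_one_le_qNorm e _ D f hq⟩
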